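/- Notation. Let \(L_s\) (\(1\le s\le\infty\)) be the space of real \(2\pi\)-periodic functions with the norm \(\|f\|_s=\big(\int_0^{2\pi}|f|^s\,dt\big)^{1/s}\) (essential supremum of \(|f|\) for \(s=\infty\)), and \(C\) the space of continuous real \(2\pi\)-periodic functions with \(\|f\|_C=\max_t|f(t)|\). For \(f\in L_1\) let \(a_k(f),b_k(f)\) be its Fourier coefficients and \(S_k(f;x)\) the \(k\)th partial sum of its Fourier series \(\frac{a_0(f)}2+\sum_{k\ge1}(a_k(f)\cos kx+b_k(f)\sin kx)\). For \(1\le p\le n\) put \(V_{n,p}(f;x)=\frac1p\sum_{k=n-p}^{n-1}S_k(f;x)\), and for a class \(\mathfrak M\subset C\) put \(\mathcal E(\mathfrak M;V_{n,p})=\sup_{f\in\mathfrak M}\|f-V_{n,p}(f;\cdot)\|_C\). For a positive sequence \(\psi=(\psi(k))_{k\ge1}\) and \(\beta\in\mathbb R\), a function \(\varphi\in L_1\) is the \((\psi,\beta)\)-derivative of \(f\in L_1\) if its Fourier series is \(\sum_{k\ge1}\frac1{\psi(k)}\big(a_k(f)\cos(kx+\frac{\beta\pi}2)+b_k(f)\sin(kx+\frac{\beta\pi}2)\big)\).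 For \(\mathfrak N\subset L_1\) let \(C^\psi_\beta\mathfrak N\) be the set of \(f\in C\) that have a \((\psi,\beta)\)-derivative in \(\mathfrak N\), and let \(C^q_\beta\mathfrak N\) be this class for \(\psi(k)=q^k\) (the Poisson integrals). Put \(U_s^0=\{\varphi\in L_s:\|\varphi\|_s\le1,\ \int_{-\pi}^{\pi}\varphi\,dt=0\}\), \(C^\psi_{\beta,s}=C^\psi_\beta U^0_s\), \(C^q_{\beta,s}=C^q_\beta U_s^0\). A modulus of continuity is a continuous nondecreasing subadditive function \(\omega\) on \([0,\infty)\) with \(\omega(0)=0\), and \(H_\omega=\{\varphi\in C:\sup_{|x-y|\le t}|\varphi(x)-\varphi(y)|\le\omega(t)\text{ for all }t\ge0\}\). For \(q\in(0,1)\) let \(D_q\) be the set of positive sequences \(\psi\) with \(\lim_{k\to\infty}\psi(k+1)/\psi(k)=q\), and put \(\varepsilon_m=\sup_{k\ge m}\big|\frac{\psi(k+1)}{\psi(k)}-q\big|\). Theorem 1. There is an absolute constant \(K>0\) such that for every \(q\in(0,1)\) and every \(\psi\in D_q\) there is \(N=N(q,\psi)\) such that for all natural \(n,p\) with \(1\le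 p\le n\) and \(n-p\ge N\) and all \(\beta\in\mathbb R\) the following holds. (i) For every \(1\le s\le\infty\), both suprema below are finite and \[\mathcal E(C^\psi_{\beta,s};V_{n,p})=\frac{\psi(n-p+1)}p\Big(\frac{p\,\mathcal E(C^q_{\beta,s};V_{n,p})}{q^{n-p+1}}+\delta\,\frac{\varepsilon_{n-p+1}}{(1-q)^2}\min\Big\{p,\frac1{1-q}\Big\}\Big)\] for some real \(\delta\) (depending on all the parameters) with \(|\delta|\le K\). (ii) For every modulus of continuity \(\omega\), both suprema below are finite and \[\mathcal E(C^\psi_\beta H_\omega;V_{n,p})=\frac{\psi(n-p+1)}p\Big(\frac{p\,\mathcal E(C^q_\beta H_\omega;V_{n,p})}{q^{n-p+1}}+\delta\,\omega\Big(\frac1{n-p+1}\Big)\frac{\varepsilon_{n-p+1}}{(1-q)^2}\min\Big\{p,\frac1{1-q}\Big\}\Big)\] for some real \(\delta\) (depending on all the parameters) with \(|\delta|\le K\). -/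

import Mathlib

open Real Set Filter Topology MeasureTheory
open scoped ENNReal

noncomputable section

namespace VPSums

/-- Cosine Fourier coefficients `a_k(f) = π⁻¹ ∫_{-π}^{π} f(t) cos(kt) dt`. -/
def fourierA (f : ℝ → ℝ) (k : ℕ) : ℝ :=
  (1 / π) * ∫ t in (-π)..π, f t * Real.cos (k * t)

/-- Sine Fourier coefficients `b_k(f) = π⁻¹ ∫_{-π}^{π} f(t) sin(kt) dt`. -/
def fourierB (f : ℝ → ℝ) (k : ℕ) : ℝ :=
  (1 / π) * ∫ t in (-π)..π, f t * Real.sin (k * t)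

/-- The partial sum `S_k(f; x)` of the Fourier series of `f`. -/
def partialSum (f : ℝ → ℝ) (k : ℕ) (x : ℝ) : ℝ :=
  fourierA f 0 / 2 +
    ∑ j ∈ Finset.Icc 1 k, (fourierA f j * Real.cos (j * x) + fourierB f j * Real.sin (j * x))

/-- The de la Vallée Poussin sum `V_{n,p}(f; x) = p⁻¹ ∑_{k=n-p}^{n-1} S_k(f; x)`
(used for `1 ≤ p ≤ n`). -/
def vallePoussin (n p : ℕ) (f : ℝ → ℝ) (x : ℝ) : ℝ :=
  (1 / (p : ℝ)) * ∑ k ∈ Finset.Ico (n - p) n, partialSum f k x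

/-- Lebesgue measure on one period `(0, 2π]`. -/
def periodMeasure : Measure ℝ := volume.restrict (Ioc 0 (2 * π))

/-- The space `L_s` of `2π`-periodic functions; the norm is `eLpNorm f s periodMeasure`. -/
def spaceL (s : ℝ≥0∞) : Set (ℝ → ℝ) :=
  {f | Function.Periodic f (2 * π) ∧ MemLp f s periodMeasure}

/-- The space `C` of continuous `2π`-periodic functions. -/
def spaceC : Set (ℝ → ℝ) :=
  {f | Function.Periodic f (2 * π) ∧ Continuous f}

/-- The uniform norm `‖f‖_C`. -/
def normC (f : ℝ → ℝ) : ℝ := ⨆ x : ℝ, |f x|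

/-- `φ ∈ L_1` is a `(ψ, β)`-derivative of `f ∈ L_1`: the Fourier series of `φ` is
`∑_{k ≥ 1} ψ(k)⁻¹ (a_k(f) cos(kx + βπ/2) + b_k(f) sin(kx + βπ/2))`. The conditions below
spell out this series coefficient by coefficient. -/
structure IsPsiBetaDeriv (ψ : ℕ → ℝ) (β : ℝ) (f φ : ℝ → ℝ) : Prop where
  left_mem : f ∈ spaceL 1
  right_mem : φ ∈ spaceL 1
  mean_zero : fourierA φ 0 = 0
  cos_coeff : ∀ k : ℕ, 1 ≤ k → fourierA φ k =
    (1 / ψ k) * (fourierA f k * Real.cos (β * π / 2) + fourierB f k * Real.sin (β * π / 2))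
  sin_coeff : ∀ k : ℕ, 1 ≤ k → fourierB φ k =
    (1 / ψ k) * (fourierB f k * Real.cos (β * π / 2) - fourierA f k * Real.sin (β * π / 2))

/-- The class `L^ψ_β 𝔑`. -/
def classL (ψ : ℕ → ℝ) (β : ℝ) (N : Set (ℝ → ℝ)) : Set (ℝ → ℝ) :=
  {f | ∃ φ ∈ N, IsPsiBetaDeriv ψ β f φ}

/-- The class `C^ψ_β 𝔑 = C ∩ L^ψ_β 𝔑`. -/
def classC (ψ : ℕ → ℝ) (β : ℝ) (N : Set (ℝ → ℝ)) : Set (ℝ → ℝ) :=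
  spaceC ∩ classL ψ β N

/-- The class `C^q_β 𝔑` of Poisson integrals: the case `ψ(k) = q^k`. -/
def classPoisson (q β : ℝ) (N : Set (ℝ → ℝ)) : Set (ℝ → ℝ) :=
  classC (fun k => q ^ k) β N

/-- `U_s^0`: the functions of the unit ball of `L_s` that are orthogonal to constants. -/
def ballU (s : ℝ≥0∞) : Set (ℝ → ℝ) :=
  {φ | φ ∈ spaceL s ∧ eLpNorm φ s periodMeasure ≤ 1 ∧ ∫ t in (-π)..π, φ t = 0}

/-- The modulus of continuity `ω(φ; t) = sup_{|x - y| ≤ t} |φ(x) - φ(y)|`. -/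
def modulus (φ : ℝ → ℝ) (t : ℝ) : ℝ :=
  sSup {d : ℝ | ∃ x y : ℝ, |x - y| ≤ t ∧ d = |φ x - φ y|}

/-- `ω` is a modulus of continuity (a majorant of modulus of continuity type) on `[0, ∞)`. -/
structure IsModulus (ω : ℝ → ℝ) : Prop where
  zero : ω 0 = 0
  continuousOn : ContinuousOn ω (Ici 0)
  monotoneOn : MonotoneOn ω (Ici 0)
  subadditive : ∀ t u : ℝ, 0 ≤ t → 0 ≤ u → ω (t + u) ≤ ω t + ω u

/-- The class `H_ω`. -/
def classH (ω : ℝ → ℝ) : Set (ℝ → ℝ) :=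
  {φ | φ ∈ spaceC ∧ ∀ t : ℝ, 0 ≤ t → modulus φ t ≤ ω t}

/-- `ψ ∈ D_q`; only the values `ψ(k)`, `k ≥ 1`, matter. -/
structure MemD (q : ℝ) (ψ : ℕ → ℝ) : Prop where
  pos : ∀ k : ℕ, 1 ≤ k → 0 < ψ k
  tendsto_ratio : Tendsto (fun k : ℕ => ψ (k + 1) / ψ k) atTop (𝓝 q)

/-- `ε_m = sup_{k ≥ m} |ψ(k+1)/ψ(k) - q|`. -/
def eps (q : ℝ) (ψ : ℕ → ℝ) (m : ℕ) : ℝ :=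
  sSup ((fun k : ℕ => |ψ (k + 1) / ψ k - q|) '' Ici m)

/-- The set of the errors `‖f - V_{n,p}(f)‖_C`, `f ∈ 𝔐`. -/
def errorSet (M : Set (ℝ → ℝ)) (n p : ℕ) : Set ℝ :=
  (fun f : ℝ → ℝ => normC (fun x => f x - vallePoussin n p f x)) '' M

/-- `𝓔(𝔐; V_{n,p}) = sup_{f ∈ 𝔐} ‖f - V_{n,p}(f)‖_C`. -/
def errorE (M : Set (ℝ → ℝ)) (n p : ℕ) : ℝ := sSup (errorSet M n p)

end VPSums

end

/-!
If `φ` is a `(ψ, β)`-derivative of a continuous `f`, the `k`th harmonic of `f` is `ψ k` times the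
phase-shifted harmonic `A_k` of `φ`, and passing from `f` to `f - V_{n,p}(f)` multiplies it by
`w_k / p`, where `w_k = missCount n p k` counts the partial sums `S_j`, `n - p ≤ j < n`, that do
not contain it. As `ψ` is summable and the `A_k` are bounded, all these series converge
absolutely, so `f - V_{n,p}(f) = p⁻¹ ∑_{k ≥ m} w_k ψ(k) A_k` with `m = n - p + 1`. Conversely every
mean-zero `φ` in the class occurs. Hence both suprema run over the same `φ`, and it suffices
to compare, for fixed `φ`, the series for `ψ` with `ψ(m) / q^m` times the series for `q^k`
(`abs_remainder_sub_le`, `abs_errorE_sub_le`).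

Writing `ε = ε_m`, once `ε ≤ (1 - q) / 2` the product of ratios satisfies
`|ψ(m+i) - ψ(m) q^i| ≤ ψ(m) i ε ρ^(i-1)` with `ρ = (1 + q) / 2` (`abs_sub_mul_pow_le`).
Combined with `w_{m+i} ≤ min(p, i + 1)`, the difference of the series is at most
`16 (ψ(m) / p) B ε (1 - q)⁻² min(p, (1 - q)⁻¹)`, where `B` bounds the Fourier coefficients
`|a_k(φ)| + |b_k(φ)|`, `k ≥ m`. For the unit ball of `L_s` one has `B = 4`, since
`‖φ‖_1 ≤ 2π ‖φ‖_s`; for `H_ω`, shifting the integral by the half-period `π / k` gives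
`|a_k|, |b_k| ≤ ω(π / k) ≤ 4 ω(1 / m)`, so `B = 8 ω(1 / m)`.
-/

noncomputable section

namespace VPSums

/-! ### Absolutely convergent trigonometric series -/

theorem fourierCoeff_lift {f : ℝ → ℝ} (hf : Continuous f) [Fact (0 < 2 * π)]
    (F : AddCircle (2 * π) → ℂ) (hF : ∀ t : ℝ, F t = f t) (n : ℤ) :
    fourierCoeff F n = ((1 / (2 * π) * ∫ t in (-π)..π, f t * Real.cos (n * t) : ℝ) : ℂ) -
      ((1 / (2 * π) * ∫ t in (-π)..π, f t * Real.sin (n * t) : ℝ) : ℂ) * Complex.I := by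
  rw [fourierCoeff_eq_intervalIntegral F n (-π), show -π + 2 * π = π by ring]
  have h : ∀ x : ℝ, (fourier (-n) (x : AddCircle (2 * π))) • F x =
      ((f x * Real.cos (n * x) : ℝ) : ℂ) - ((f x * Real.sin (n * x) : ℝ) : ℂ) * Complex.I := by
    intro x
    rw [fourier_coe_apply, hF]
    have : 2 * (π : ℂ) * Complex.I * ((-n : ℤ) : ℂ) * x / ((2 * π : ℝ) : ℂ) =
        ((-(n * x) : ℝ) : ℂ) * Complex.I := by
      have : (π : ℂ) ≠ 0 := by exact_mod_cast pi_ne_zero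
      push_cast
      field_simp
    rw [this, Complex.exp_mul_I, ← Complex.ofReal_cos, ← Complex.ofReal_sin, Real.cos_neg,
      Real.sin_neg, smul_eq_mul]
    push_cast
    ring
  simp_rw [h]
  rw [intervalIntegral.integral_sub, intervalIntegral.integral_mul_const,
    intervalIntegral.integral_ofReal, intervalIntegral.integral_ofReal, Complex.real_smul]
  · push_cast
    ring
  · exact Continuous.intervalIntegrable (by fun_prop) _ _
  · exact Continuous.intervalIntegrable (by fun_prop) _ _

/-- The real Fourier series of `f`, summed from `k = 0`. The term at `0` is `a_0(f)`, not
`a_0(f) / 2`, which accounts for the extra summand in the limit. -/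
theorem hasSum_fourier {f : ℝ → ℝ} (hf : f ∈ spaceC)
    (hs : Summable fun k => |fourierA f k| + |fourierB f k|) (x : ℝ) :
    HasSum (fun k : ℕ => fourierA f k * Real.cos (k * x) + fourierB f k * Real.sin (k * x))
      (f x + fourierA f 0 / 2) := by
  have : Fact (0 < 2 * π) := ⟨two_pi_pos⟩
  obtain ⟨hp, hc⟩ := hf
  have hpc : Function.Periodic (fun t => (f t : ℂ)) (2 * π) := fun t => by simp [hp t]
  have hcont : Continuous (hpc.lift : AddCircle (2 * π) → ℂ) :=
    continuous_quot_lift _ (by fun_prop)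
  let F : C(AddCircle (2 * π), ℂ) := ⟨hpc.lift, hcont⟩
  have hF : ∀ t : ℝ, F t = f t := fun t => rfl
  have hpos : ∀ k : ℕ, fourierCoeff F (k : ℤ) =
      (((fourierA f k / 2 : ℝ) : ℂ) - ((fourierB f k / 2 : ℝ) : ℂ) * Complex.I) := by
    intro k
    rw [fourierCoeff_lift hc F hF, fourierA, fourierB]
    push_cast
    ring
  have hneg : ∀ k : ℕ, fourierCoeff F (-(k : ℤ)) =
      (((fourierA f k / 2 : ℝ) : ℂ) + ((fourierB f k / 2 : ℝ) : ℂ) * Complex.I) := by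
    intro k
    rw [fourierCoeff_lift hc F hF, fourierA, fourierB]
    simp only [Int.cast_neg, Int.cast_natCast, neg_mul, Real.cos_neg, Real.sin_neg, mul_neg,
      intervalIntegral.integral_neg]
    push_cast
    ring
  have hsum : Summable (fourierCoeff F) := by
    refine Summable.of_nat_of_neg (Summable.of_norm_bounded hs fun k => ?_)
      (Summable.of_norm_bounded hs fun k => ?_)
    · rw [hpos]
      refine (norm_sub_le _ _).trans ?_
      rw [norm_mul, Complex.norm_I, mul_one, Complex.norm_real, Complex.norm_real,
        Real.norm_eq_abs, Real.norm_eq_abs, abs_div, abs_div, abs_two]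
      linarith [abs_nonneg (fourierA f k), abs_nonneg (fourierB f k)]
    · rw [hneg]
      refine (norm_add_le _ _).trans ?_
      rw [norm_mul, Complex.norm_I, mul_one, Complex.norm_real, Complex.norm_real,
        Real.norm_eq_abs, Real.norm_eq_abs, abs_div, abs_div, abs_two]
      linarith [abs_nonneg (fourierA f k), abs_nonneg (fourierB f k)]
  have key := (has_pointwise_sum_fourier_series_of_summable hsum (x : AddCircle (2 * π))).nat_add_neg
  have hb0 : fourierB f 0 = 0 := by simp [fourierB]
  have h0 : fourierCoeff F 0 = ((fourierA f 0 / 2 : ℝ) : ℂ) := by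
    simpa [hb0] using hpos 0
  rw [hF, h0, fourier_zero, smul_eq_mul, mul_one, ← Complex.ofReal_add] at key
  refine Complex.hasSum_ofReal.1 ?_
  refine key.congr_fun ?_
  intro k
  have he : ∀ n : ℤ, (fourier n (x : AddCircle (2 * π)) : ℂ) =
      (Real.cos (n * x) : ℂ) + (Real.sin (n * x) : ℂ) * Complex.I := by
    intro n
    rw [fourier_coe_apply]
    have : 2 * (π : ℂ) * Complex.I * (n : ℂ) * x / ((2 * π : ℝ) : ℂ) =
        ((n * x : ℝ) : ℂ) * Complex.I := by
      have : (π : ℂ) ≠ 0 := by exact_mod_cast pi_ne_zero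
      push_cast
      field_simp
    rw [this, Complex.exp_mul_I, ← Complex.ofReal_cos, ← Complex.ofReal_sin]
  rw [hpos, hneg, he, he]
  simp only [Int.cast_neg, Int.cast_natCast, neg_mul, Real.cos_neg, Real.sin_neg, smul_eq_mul]
  push_cast
  linear_combination ((fourierB f k : ℂ) * Complex.sin (k * x)) * Complex.I_sq

theorem integral_cos_int_mul {l : ℤ} (hl : l ≠ 0) : ∫ t in (-π)..π, Real.cos (l * t) = 0 := by
  have : (l : ℝ) ≠ 0 := by exact_mod_cast hl
  rw [intervalIntegral.integral_comp_mul_left (fun t => Real.cos t) this, integral_cos]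
  simp [Real.sin_int_mul_pi]

theorem integral_sin_int_mul (l : ℤ) : ∫ t in (-π)..π, Real.sin (l * t) = 0 := by
  rcases eq_or_ne l 0 with rfl | hl
  · simp
  have : (l : ℝ) ≠ 0 := by exact_mod_cast hl
  rw [intervalIntegral.integral_comp_mul_left (fun t => Real.sin t) this, integral_sin]
  simp

theorem integral_cos_mul_cos (j k : ℕ) (hj : 1 ≤ j) :
    ∫ t in (-π)..π, Real.cos (j * t) * Real.cos (k * t) = if j = k then π else 0 := by
  have h : ∀ t : ℝ, Real.cos (j * t) * Real.cos (k * t) =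
      (1 / 2) * (Real.cos (((j - k : ℤ) : ℝ) * t) + Real.cos (((j + k : ℤ) : ℝ) * t)) := by
    intro t
    push_cast
    rw [sub_mul, add_mul, Real.cos_sub, Real.cos_add]
    ring
  simp_rw [h]
  rw [intervalIntegral.integral_const_mul, intervalIntegral.integral_add
    (Continuous.intervalIntegrable (by fun_prop) _ _)
    (Continuous.intervalIntegrable (by fun_prop) _ _),
    integral_cos_int_mul (l := (j + k : ℤ)) (by omega)]
  split_ifs with hjk
  · subst hjk; simp; ring
  · rw [integral_cos_int_mul (by omega)]; simp

theorem integral_sin_mul_sin (j k : ℕ) (hj : 1 ≤ j) :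
    ∫ t in (-π)..π, Real.sin (j * t) * Real.sin (k * t) = if j = k then π else 0 := by
  have h : ∀ t : ℝ, Real.sin (j * t) * Real.sin (k * t) =
      (1 / 2) * (Real.cos (((j - k : ℤ) : ℝ) * t) - Real.cos (((j + k : ℤ) : ℝ) * t)) := by
    intro t
    push_cast
    rw [sub_mul, add_mul, Real.cos_sub, Real.cos_add]
    ring
  simp_rw [h]
  rw [intervalIntegral.integral_const_mul, intervalIntegral.integral_sub
    (Continuous.intervalIntegrable (by fun_prop) _ _)
    (Continuous.intervalIntegrable (by fun_prop) _ _),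
    integral_cos_int_mul (l := (j + k : ℤ)) (by omega)]
  split_ifs with hjk
  · subst hjk; simp; ring
  · rw [integral_cos_int_mul (by omega)]; simp

theorem integral_sin_mul_cos (j k : ℕ) :
    ∫ t in (-π)..π, Real.sin (j * t) * Real.cos (k * t) = 0 := by
  have h : ∀ t : ℝ, Real.sin (j * t) * Real.cos (k * t) =
      (1 / 2) * (Real.sin (((j - k : ℤ) : ℝ) * t) + Real.sin (((j + k : ℤ) : ℝ) * t)) := by
    intro t
    push_cast
    rw [sub_mul, add_mul, Real.sin_sub, Real.sin_add]
    ring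
  simp_rw [h]
  rw [intervalIntegral.integral_const_mul, intervalIntegral.integral_add
    (Continuous.intervalIntegrable (by fun_prop) _ _)
    (Continuous.intervalIntegrable (by fun_prop) _ _),
    integral_sin_int_mul, integral_sin_int_mul]
  simp

/-- An absolutely convergent trigonometric series is a continuous periodic function whose
Fourier coefficients are the coefficients of the series. -/
theorem exists_spaceC_of_summable {c d : ℕ → ℝ} (hc : Summable fun k => |c k|)
    (hd : Summable fun k => |d k|) :
    ∃ f ∈ spaceC, ∀ k, 1 ≤ k → fourierA f k = c k ∧ fourierB f k = d k := by
  let T : ℕ → C(ℝ, ℝ) := fun k => ⟨fun t => c (k + 1) * Real.cos ((k + 1 : ℕ) * t) +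
    d (k + 1) * Real.sin ((k + 1 : ℕ) * t), by fun_prop⟩
  have hu : Summable fun k => |c (k + 1)| + |d (k + 1)| :=
    (hc.add hd).comp_injective (add_left_injective 1)
  have hb : ∀ k t, |T k t| ≤ |c (k + 1)| + |d (k + 1)| := by
    intro k t
    refine (abs_add_le _ _).trans (add_le_add ?_ ?_) <;> rw [abs_mul]
    · exact mul_le_of_le_one_right (abs_nonneg _) (Real.abs_cos_le_one _)
    · exact mul_le_of_le_one_right (abs_nonneg _) (Real.abs_sin_le_one _)
  have hsum : ∀ t, HasSum (fun k => T k t) (∑' k, T k t) := fun t =>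
    (Summable.of_norm_bounded hu fun k => hb k t).hasSum
  have hint : ∀ (g : ℝ → ℝ), Continuous g → (∀ t, |g t| ≤ 1) →
      HasSum (fun k => ∫ t in (-π)..π, T k t * g t)
        (∫ t in (-π)..π, (∑' k, T k t) * g t) := by
    intro g hg hg1
    refine intervalIntegral.hasSum_integral_of_dominated_convergence
      (fun k _ => |c (k + 1)| + |d (k + 1)|) (fun k => ?_) (fun k => ?_) ?_ ?_ ?_
    · exact (Continuous.aestronglyMeasurable (by fun_prop))
    · refine ae_of_all _ fun t _ => ?_
      rw [Real.norm_eq_abs, abs_mul]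
      exact (mul_le_of_le_one_right (abs_nonneg _) (hg1 t)).trans (hb k t)
    · exact ae_of_all _ fun t _ => hu
    · exact intervalIntegrable_const
    · exact ae_of_all _ fun t _ => (hsum t).mul_right _
  refine ⟨fun t => ∑' k, T k t, ⟨fun t => ?_, ?_⟩, fun j hj => ⟨?_, ?_⟩⟩
  · refine tsum_congr fun k => ?_
    simp only [T, ContinuousMap.coe_mk]
    rw [mul_add, Real.cos_add_nat_mul_two_pi, Real.sin_add_nat_mul_two_pi]
  · exact continuous_tsum (fun k => (T k).continuous) hu hb
  · have h := hint (fun t => Real.cos (j * t)) (by fun_prop) fun t => Real.abs_cos_le_one _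
    have h2 : ∀ k, ∫ t in (-π)..π, T k t * Real.cos (j * t) =
        if k = j - 1 then π * c j else 0 := by
      intro k
      have : ∀ t, T k t * Real.cos (j * t) =
          c (k + 1) * (Real.cos ((k + 1 : ℕ) * t) * Real.cos (j * t)) +
          d (k + 1) * (Real.sin ((k + 1 : ℕ) * t) * Real.cos (j * t)) := fun t => by
        simp only [T, ContinuousMap.coe_mk]; ring
      simp_rw [this]
      rw [intervalIntegral.integral_add (Continuous.intervalIntegrable (by fun_prop) _ _)
        (Continuous.intervalIntegrable (by fun_prop) _ _), intervalIntegral.integral_const_mul,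
        intervalIntegral.integral_const_mul, integral_cos_mul_cos _ _ (by omega),
        integral_sin_mul_cos]
      by_cases hk : k + 1 = j
      · rw [if_pos hk, if_pos (by omega), hk]; ring
      · rw [if_neg hk, if_neg (by omega)]; ring
    simp_rw [h2] at h
    rw [fourierA, h.unique (hasSum_ite_eq (j - 1) (π * c j))]
    field_simp
  · have h := hint (fun t => Real.sin (j * t)) (by fun_prop) fun t => Real.abs_sin_le_one _
    have h2 : ∀ k, ∫ t in (-π)..π, T k t * Real.sin (j * t) =
        if k = j - 1 then π * d j else 0 := by
      intro k
      have : ∀ t, T k t * Real.sin (j * t) =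
          c (k + 1) * (Real.sin (j * t) * Real.cos ((k + 1 : ℕ) * t)) +
          d (k + 1) * (Real.sin ((k + 1 : ℕ) * t) * Real.sin (j * t)) := fun t => by
        simp only [T, ContinuousMap.coe_mk]; ring
      simp_rw [this]
      rw [intervalIntegral.integral_add (Continuous.intervalIntegrable (by fun_prop) _ _)
        (Continuous.intervalIntegrable (by fun_prop) _ _), intervalIntegral.integral_const_mul,
        intervalIntegral.integral_const_mul, integral_sin_mul_sin _ _ (by omega),
        integral_sin_mul_cos]
      by_cases hk : k + 1 = j
      · rw [if_pos hk, if_pos (by omega), hk]; ring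
      · rw [if_neg hk, if_neg (by omega)]; ring
    simp_rw [h2] at h
    rw [fourierB, h.unique (hasSum_ite_eq (j - 1) (π * d j))]
    field_simp

/-! ### The error as a series in the harmonics of the derivative -/

/-- The number of partial sums `S_k`, `n - p ≤ k < n`, that miss the `j`th harmonic. Divided by
`p`, it is the factor by which `f ↦ f - V_{n,p}(f)` multiplies that harmonic. -/
def missCount (n p j : ℕ) : ℕ := ((Finset.Ico (n - p) n).filter (· < j)).card

theorem missCount_le {n p : ℕ} (hpn : p ≤ n) (j : ℕ) : missCount n p j ≤ p := by
  refine (Finset.card_filter_le _ _).trans ?_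
  rw [Nat.card_Ico]; omega

theorem missCount_le_sub (n p j : ℕ) : missCount n p j ≤ j - (n - p) := by
  rw [← Nat.card_Ico]
  refine Finset.card_le_card fun k hk => ?_
  simp only [Finset.mem_filter, Finset.mem_Ico] at hk ⊢
  omega

theorem missCount_eq_zero {n p j : ℕ} (h : j ≤ n - p) : missCount n p j = 0 := by
  have := missCount_le_sub n p j
  omega

theorem hasSum_sub_vallePoussin {f : ℝ → ℝ} (hf : f ∈ spaceC)
    (hs : Summable fun k => |fourierA f k| + |fourierB f k|) {n p : ℕ} (hp : 1 ≤ p)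
    (hpn : p ≤ n) (x : ℝ) :
    HasSum (fun j : ℕ => (missCount n p j / p : ℝ) *
      (fourierA f j * Real.cos (j * x) + fourierB f j * Real.sin (j * x)))
      (f x - vallePoussin n p f x) := by
  set h : ℕ → ℝ := fun j => fourierA f j * Real.cos (j * x) + fourierB f j * Real.sin (j * x)
    with hh
  have hS : ∀ k, HasSum (fun j => if k < j then h j else 0) (f x - partialSum f k x) := by
    intro k
    have h1 := hasSum_fourier hf hs x
    have h2 : HasSum (fun j => if j ∈ Finset.range (k + 1) then h j else 0)
        (∑ j ∈ Finset.range (k + 1), h j) := by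
      have := hasSum_sum_of_ne_finset_zero (L := SummationFilter.unconditional ℕ)
        (f := fun j => if j ∈ Finset.range (k + 1) then h j else 0)
        (s := Finset.range (k + 1)) (fun b hb => if_neg hb)
      rwa [Finset.sum_congr rfl fun j hj => if_pos hj] at this
    have h3 : ∑ j ∈ Finset.range (k + 1), h j = partialSum f k x + fourierA f 0 / 2 := by
      have : Finset.Ico (0 + 1) (k + 1) = Finset.Icc 1 k := by ext; simp
      rw [partialSum, Finset.sum_range_succ', Finset.range_eq_Ico, Finset.sum_Ico_add' h 0 k 1,
        this]
      simp only [hh, CharP.cast_eq_zero, zero_mul, Real.cos_zero, Real.sin_zero]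
      ring
    have h4 := h1.sub h2
    rw [h3, add_sub_add_right_eq_sub] at h4
    refine h4.congr_fun fun j => ?_
    by_cases hj : k < j
    · rw [if_pos hj, if_neg (by simp; omega), sub_zero]
    · rw [if_neg hj, if_pos (by simp; omega), sub_self]
  have hp0 : (p : ℝ) ≠ 0 := by positivity
  have key := (hasSum_sum fun k (_ : k ∈ Finset.Ico (n - p) n) => hS k).mul_left (1 / (p : ℝ))
  have hcard : ((Finset.Ico (n - p) n).card : ℝ) = p := by
    rw [Nat.card_Ico]; congr 1; omega
  rw [Finset.sum_sub_distrib, Finset.sum_const, nsmul_eq_mul, hcard, mul_sub, ← mul_assoc,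
    one_div_mul_cancel hp0, one_mul] at key
  refine key.congr_fun fun j => ?_
  rw [← Finset.sum_filter, Finset.sum_const, nsmul_eq_mul, missCount]
  ring

/-- The `k`th harmonic of `φ` with its phase shifted by `-βπ/2`; multiplied by `ψ k`, it is the
`k`th harmonic of a function with `(ψ, β)`-derivative `φ`. -/
def harmonic (φ : ℝ → ℝ) (β : ℝ) (k : ℕ) (x : ℝ) : ℝ :=
  fourierA φ k * Real.cos (k * x - β * π / 2) + fourierB φ k * Real.sin (k * x - β * π / 2)

theorem abs_harmonic_le (φ : ℝ → ℝ) (β : ℝ) (k : ℕ) (x : ℝ) :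
    |harmonic φ β k x| ≤ |fourierA φ k| + |fourierB φ k| := by
  refine (abs_add_le _ _).trans (add_le_add ?_ ?_) <;> rw [abs_mul]
  · exact mul_le_of_le_one_right (abs_nonneg _) (Real.abs_cos_le_one _)
  · exact mul_le_of_le_one_right (abs_nonneg _) (Real.abs_sin_le_one _)

/-- The error `f - V_{n,p}(f)`, expressed through the `(ψ, β)`-derivative `φ` of `f`. -/
def remainder (ψ : ℕ → ℝ) (β : ℝ) (n p : ℕ) (φ : ℝ → ℝ) (x : ℝ) : ℝ :=
  ∑' j, (missCount n p j / p : ℝ) * (ψ j * harmonic φ β j x)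

section Classes

variable {ψ : ℕ → ℝ} {β B : ℝ} {n p : ℕ} {φ f : ℝ → ℝ}

theorem IsPsiBetaDeriv.coeff_eq (hψ : ∀ k, 1 ≤ k → 0 < ψ k) (h : IsPsiBetaDeriv ψ β f φ)
    {k : ℕ} (hk : 1 ≤ k) :
    fourierA f k = ψ k * (fourierA φ k * Real.cos (β * π / 2) -
      fourierB φ k * Real.sin (β * π / 2)) ∧
    fourierB f k = ψ k * (fourierB φ k * Real.cos (β * π / 2) +
      fourierA φ k * Real.sin (β * π / 2)) := by
  have h0 := (hψ k hk).ne'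
  have h1 := Real.sin_sq_add_cos_sq (β * π / 2)
  rw [h.cos_coeff k hk, h.sin_coeff k hk]
  constructor
  · field_simp
    linear_combination (-fourierA f k) * h1
  · field_simp
    linear_combination (-fourierB f k) * h1

theorem abs_rotate_le (a b c s : ℝ) (hc : |c| ≤ 1) (hs : |s| ≤ 1) :
    |a * c - b * s| ≤ |a| + |b| := by
  refine (abs_sub _ _).trans (add_le_add ?_ ?_) <;> rw [abs_mul]
  · exact mul_le_of_le_one_right (abs_nonneg _) hc
  · exact mul_le_of_le_one_right (abs_nonneg _) hs

theorem sub_vallePoussin_eq_remainder (hψ : ∀ k, 1 ≤ k → 0 < ψ k) (hsum : Summable ψ)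
    (hB : ∀ k, 1 ≤ k → |fourierA φ k| + |fourierB φ k| ≤ B) (hp : 1 ≤ p) (hpn : p ≤ n)
    (hf : f ∈ spaceC) (h : IsPsiBetaDeriv ψ β f φ) (x : ℝ) :
    f x - vallePoussin n p f x = remainder ψ β n p φ x := by
  have hs : Summable fun k => |fourierA f k| + |fourierB f k| := by
    rw [← summable_nat_add_iff 1]
    refine Summable.of_nonneg_of_le (fun k => by positivity) (fun k => ?_)
      (((summable_nat_add_iff 1).2 hsum).mul_right (2 * B))
    obtain ⟨ha, hb⟩ := h.coeff_eq hψ (Nat.le_add_left 1 k)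
    have h1 := hB (k + 1) (by omega)
    have h2 := hψ (k + 1) (by omega)
    rw [ha, hb, abs_mul, abs_mul, abs_of_pos h2, ← mul_add]
    refine mul_le_mul_of_nonneg_left ?_ h2.le
    have h3 := abs_rotate_le (fourierA φ (k + 1)) (fourierB φ (k + 1)) _ _
      (Real.abs_cos_le_one (β * π / 2)) (Real.abs_sin_le_one (β * π / 2))
    have h4 := abs_rotate_le (fourierB φ (k + 1)) (-fourierA φ (k + 1)) _ _
      (Real.abs_cos_le_one (β * π / 2)) (Real.abs_sin_le_one (β * π / 2))
    rw [neg_mul, sub_neg_eq_add, abs_neg] at h4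
    linarith
  rw [← (hasSum_sub_vallePoussin hf hs hp hpn x).tsum_eq, remainder]
  refine tsum_congr fun j => ?_
  rcases Nat.eq_zero_or_pos j with rfl | hj
  · simp [missCount_eq_zero]
  · obtain ⟨ha, hb⟩ := h.coeff_eq hψ hj
    rw [ha, hb, harmonic, Real.cos_sub, Real.sin_sub]
    ring

theorem mem_spaceL_of_mem_spaceC (hf : f ∈ spaceC) (s : ℝ≥0∞) : f ∈ spaceL s := by
  obtain ⟨hp, hc⟩ := hf
  obtain ⟨C, hC⟩ := (hp.isBounded_of_continuous two_pi_pos.ne' hc).exists_norm_le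
  have : IsFiniteMeasure periodMeasure := by unfold periodMeasure; infer_instance
  exact ⟨hp, MemLp.of_bound hc.aestronglyMeasurable C
    (ae_of_all _ fun t => hC _ (mem_range_self t))⟩

/-- Every mean-zero `φ` with bounded Fourier coefficients is the `(ψ, β)`-derivative of some
continuous function. -/
theorem exists_isPsiBetaDeriv (hψ : ∀ k, 1 ≤ k → 0 < ψ k) (hsum : Summable ψ)
    (hB : ∀ k, 1 ≤ k → |fourierA φ k| + |fourierB φ k| ≤ B) (hφ : φ ∈ spaceL 1)
    (h0 : fourierA φ 0 = 0) : ∃ f ∈ spaceC, IsPsiBetaDeriv ψ β f φ := by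
  have hrot : ∀ u v : ℕ → ℝ, (∀ k, 1 ≤ k → |u k| + |v k| ≤ B) →
      Summable fun k => |ψ k * (u k * Real.cos (β * π / 2) - v k * Real.sin (β * π / 2))| := by
    intro u v huv
    rw [← summable_nat_add_iff 1]
    refine Summable.of_nonneg_of_le (fun k => abs_nonneg _) (fun k => ?_)
      (((summable_nat_add_iff 1).2 hsum).mul_right B)
    have h2 := hψ (k + 1) (by omega)
    rw [abs_mul, abs_of_pos h2]
    exact mul_le_mul_of_nonneg_left ((abs_rotate_le _ _ _ _ (Real.abs_cos_le_one _)
      (Real.abs_sin_le_one _)).trans (huv _ (by omega))) h2.le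
  obtain ⟨f, hf, hcoef⟩ := exists_spaceC_of_summable (hrot (fourierA φ) (fourierB φ) hB)
    (hrot (fourierB φ) (fun k => -fourierA φ k) fun k hk => by
      rw [abs_neg, add_comm]; exact hB k hk)
  have h1 := Real.sin_sq_add_cos_sq (β * π / 2)
  refine ⟨f, hf, mem_spaceL_of_mem_spaceC hf 1, hφ, h0, fun k hk => ?_, fun k hk => ?_⟩
  all_goals
    have h2 := (hψ k hk).ne'
    rw [(hcoef k hk).1, (hcoef k hk).2]
    field_simp
  · linear_combination (-fourierA φ k) * h1
  · linear_combination (-fourierB φ k) * h1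

/-- The errors on `C^ψ_β N` are indexed by the admissible derivatives `φ ∈ N`, a set that does not
depend on `ψ`. -/
theorem errorSet_classC_eq {N : Set (ℝ → ℝ)} (hψ : ∀ k, 1 ≤ k → 0 < ψ k) (hsum : Summable ψ)
    (hB : ∀ φ ∈ N, ∀ k, 1 ≤ k → |fourierA φ k| + |fourierB φ k| ≤ B) (hp : 1 ≤ p)
    (hpn : p ≤ n) :
    errorSet (classC ψ β N) n p =
      (fun φ => normC (remainder ψ β n p φ)) '' {φ ∈ N | φ ∈ spaceL 1 ∧ fourierA φ 0 = 0} := by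
  ext r
  constructor
  · rintro ⟨f, ⟨hf, φ, hφ, hd⟩, rfl⟩
    refine ⟨φ, ⟨hφ, hd.right_mem, hd.mean_zero⟩, ?_⟩
    exact congrArg normC (funext fun x =>
      (sub_vallePoussin_eq_remainder hψ hsum (hB φ hφ) hp hpn hf hd x).symm)
  · rintro ⟨φ, ⟨hφ, h1, h0⟩, rfl⟩
    obtain ⟨f, hf, hd⟩ := exists_isPsiBetaDeriv (β := β) hψ hsum (hB φ hφ) h1 h0
    refine ⟨f, ⟨hf, φ, hφ, hd⟩, ?_⟩
    exact congrArg normC (funext fun x =>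
      sub_vallePoussin_eq_remainder hψ hsum (hB φ hφ) hp hpn hf hd x)

theorem abs_remainder_term_le
    (hB : ∀ k, 1 ≤ k → |fourierA φ k| + |fourierB φ k| ≤ B) (hpn : p ≤ n) (x : ℝ) (j : ℕ) :
    |(missCount n p j / p : ℝ) * (ψ j * harmonic φ β j x)| ≤ |ψ j| * B := by
  have hB0 : 0 ≤ B := le_trans (by positivity) (hB 1 le_rfl)
  rcases Nat.eq_zero_or_pos j with rfl | hj
  · rw [missCount_eq_zero (Nat.zero_le _)]
    simp; positivity
  · rw [abs_mul, abs_mul]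
    have h1 : |(missCount n p j / p : ℝ)| ≤ 1 := by
      rw [abs_of_nonneg (by positivity)]
      exact div_le_one_of_le₀ (by exact_mod_cast missCount_le hpn j) (by positivity)
    refine (mul_le_of_le_one_left (by positivity) h1).trans ?_
    exact mul_le_mul_of_nonneg_left ((abs_harmonic_le _ _ _ _).trans (hB j hj)) (abs_nonneg _)

theorem hasSum_remainder (hsum : Summable ψ)
    (hB : ∀ k, 1 ≤ k → |fourierA φ k| + |fourierB φ k| ≤ B) (hpn : p ≤ n) (x : ℝ) :
    HasSum (fun j => (missCount n p j / p : ℝ) * (ψ j * harmonic φ β j x))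
      (remainder ψ β n p φ x) :=
  (Summable.of_norm_bounded (hsum.abs.mul_right B) (abs_remainder_term_le hB hpn x)).hasSum

theorem abs_remainder_le (hsum : Summable ψ)
    (hB : ∀ k, 1 ≤ k → |fourierA φ k| + |fourierB φ k| ≤ B) (hpn : p ≤ n) (x : ℝ) :
    |remainder ψ β n p φ x| ≤ (∑' j, |ψ j|) * B := by
  rw [← Real.norm_eq_abs]
  exact tsum_of_norm_bounded (hsum.abs.hasSum.mul_right B) (abs_remainder_term_le hB hpn x)

end Classes

/-! ### Comparison of `ψ` with a geometric progression -/

theorem MemD.summable {q : ℝ} {ψ : ℕ → ℝ} (hq1 : q < 1) (h : MemD q ψ) : Summable ψ := by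
  refine summable_of_ratio_test_tendsto_lt_one hq1 ?_ ?_
  · filter_upwards [eventually_ge_atTop 1] with k hk using (h.pos k hk).ne'
  · refine h.tendsto_ratio.congr' ?_
    filter_upwards [eventually_ge_atTop 1] with k hk
    rw [Real.norm_of_nonneg (h.pos k hk).le, Real.norm_of_nonneg (h.pos (k + 1) (by omega)).le]

theorem memD_pow {q : ℝ} (hq : 0 < q) : MemD q fun k => q ^ k where
  pos k _ := pow_pos hq k
  tendsto_ratio := by
    refine tendsto_const_nhds.congr fun k => ?_
    rw [pow_succ]; field_simp

/-- If consecutive ratios of `ψ` from `m` on are within `ε` of `q`, then `ψ (m + i)` stays close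
to `ψ m * q ^ i`, with an error that decays geometrically. -/
theorem abs_sub_mul_pow_le {ψ : ℕ → ℝ} {q ε ρ : ℝ} {m : ℕ} (hq : 0 < q) (hρ : q + ε ≤ ρ)
    (hpos : ∀ k, m ≤ k → 0 < ψ k) (hε : ∀ k, m ≤ k → |ψ (k + 1) / ψ k - q| ≤ ε) (i : ℕ) :
    |ψ (m + 1 + i) - ψ m * q ^ (i + 1)| ≤ ψ m * ((i + 1) * ε * ρ ^ i) := by
  have hε0 : 0 ≤ ε := (abs_nonneg _).trans (hε m le_rfl)
  have hρ0 : 0 ≤ ρ := by linarith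
  have hstep : ∀ k, m ≤ k → |ψ (k + 1) - q * ψ k| ≤ ε * ψ k := by
    intro k hk
    have h0 := hpos k hk
    have : ψ (k + 1) - q * ψ k = (ψ (k + 1) / ψ k - q) * ψ k := by field_simp
    rw [this, abs_mul, abs_of_pos h0]
    exact mul_le_mul_of_nonneg_right (hε k hk) h0.le
  have hgrow : ∀ i, ψ (m + i) ≤ ψ m * ρ ^ i := by
    intro i
    induction i with
    | zero => simp
    | succ i ih =>
      have h1 := (abs_le.1 (hstep (m + i) (by omega))).2
      have h0 := hpos (m + i) (by omega)
      calc ψ (m + (i + 1)) ≤ (q + ε) * ψ (m + i) := by rw [← add_assoc]; linarith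
        _ ≤ ρ * (ψ m * ρ ^ i) := by gcongr
        _ = ψ m * ρ ^ (i + 1) := by ring
  induction i with
  | zero =>
    have := hstep m le_rfl
    simp only [add_zero, zero_add, pow_one, CharP.cast_eq_zero, one_mul, pow_zero, mul_one]
    rwa [mul_comm q, mul_comm ε] at this
  | succ i ih =>
    have h1 := hstep (m + 1 + i) (by omega)
    have h2 := hgrow (i + 1)
    rw [show m + (i + 1) = m + 1 + i by ring] at h2
    have h3 : ψ (m + 1 + (i + 1)) - ψ m * q ^ (i + 1 + 1) =
        (ψ (m + 1 + i + 1) - q * ψ (m + 1 + i)) +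
          q * (ψ (m + 1 + i) - ψ m * q ^ (i + 1)) := by
      rw [show m + 1 + (i + 1) = m + 1 + i + 1 by ring]; ring
    rw [h3]
    refine (abs_add_le _ _).trans ?_
    rw [abs_mul, abs_of_pos hq]
    have hm := (hpos m le_rfl).le
    calc _ ≤ ε * (ψ m * ρ ^ (i + 1)) + ρ * (ψ m * ((i + 1) * ε * ρ ^ i)) := by
          refine add_le_add (h1.trans (by gcongr)) ?_
          gcongr
          linarith
      _ = _ := by push_cast; ring

/-- The two bounds behind the minimum come from `missCount n p (m + 1 + i) ≤ p`, with
`∑ (i + 1) ρ^i = (1 - ρ)⁻²`, and from `missCount n p (m + 1 + i) ≤ i + 2`, with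
`∑ (i + 2) (i + 1) ρ^i = 2 (1 - ρ)⁻³`, where `1 - ρ = (1 - q) / 2`. -/
theorem abs_remainder_sub_le {ψ : ℕ → ℝ} {q ε β B B₀ : ℝ} {n p : ℕ} {φ : ℝ → ℝ} (hq : 0 < q)
    (hq1 : q < 1) (hψ : MemD q ψ) (hp : 1 ≤ p) (hpn : p ≤ n)
    (hε : ∀ k, n - p + 1 ≤ k → |ψ (k + 1) / ψ k - q| ≤ ε) (hεq : ε ≤ (1 - q) / 2)
    (hB₀ : ∀ k, 1 ≤ k → |fourierA φ k| + |fourierB φ k| ≤ B₀)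
    (hB : ∀ k, n - p + 1 ≤ k → |fourierA φ k| + |fourierB φ k| ≤ B) (x : ℝ) :
    |remainder ψ β n p φ x -
      ψ (n - p + 1) / q ^ (n - p + 1) * remainder (fun k => q ^ k) β n p φ x| ≤
      ψ (n - p + 1) / p * (16 * B * (ε / (1 - q) ^ 2) * min (p : ℝ) (1 / (1 - q))) := by
  have hm1 : n - p < n - p + 1 := Nat.lt_succ_self _
  set m := n - p + 1 with hm
  clear_value m
  have hψm := hψ.pos m (by omega)
  have hε0 : 0 ≤ ε := (abs_nonneg _).trans (hε m le_rfl)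
  have hB0 : 0 ≤ B := le_trans (by positivity) (hB m le_rfl)
  have hp0 : (0 : ℝ) < p := by exact_mod_cast hp
  obtain ⟨ρ, hρ⟩ : ∃ ρ, ρ = (1 + q) / 2 := ⟨_, rfl⟩
  have hρ1 : 1 - ρ = (1 - q) / 2 := by rw [hρ]; ring
  have hρ0 : 0 < ρ := by rw [hρ]; linarith
  have hnorm : ‖ρ‖ < 1 := by rw [Real.norm_of_nonneg hρ0.le]; linarith
  have hq2 : 0 < 1 - q := by linarith
  have h1 := (hasSum_remainder (β := β) (hψ.summable hq1) hB₀ hpn x).sub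
    ((hasSum_remainder (β := β) ((memD_pow hq).summable hq1) hB₀ hpn x).mul_left
      (ψ m / q ^ m))
  have h2 := (hasSum_nat_add_iff' (m + 1)).2 h1
  rw [Finset.sum_eq_zero (fun j hj => ?_), sub_zero] at h2
  swap
  · -- the weights vanish below `m`, and at `m` the two terms agree
    rcases (Nat.lt_succ_iff.1 (Finset.mem_range.1 hj)).lt_or_eq with hj | rfl
    · rw [missCount_eq_zero (by omega)]; simp
    · field_simp; ring
  have hterm : ∀ i, ‖(missCount n p (i + (m + 1)) / p : ℝ) *
        (ψ (i + (m + 1)) * harmonic φ β (i + (m + 1)) x) - ψ m / q ^ m *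
        ((missCount n p (i + (m + 1)) / p : ℝ) *
        (q ^ (i + (m + 1)) * harmonic φ β (i + (m + 1)) x))‖ ≤
      (ψ m * ε * B / p) * (missCount n p (i + (m + 1)) * ((i + 1) * ρ ^ i)) := by
    intro i
    have h3 := abs_sub_mul_pow_le (ρ := ρ) hq (by linarith) (fun k hk => hψ.pos k (by omega)) hε i
    have h4 := (abs_harmonic_le φ β (i + (m + 1)) x).trans (hB _ (by omega))
    have h5 : (missCount n p (i + (m + 1)) / p : ℝ) *
        (ψ (i + (m + 1)) * harmonic φ β (i + (m + 1)) x) - ψ m / q ^ m *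
        ((missCount n p (i + (m + 1)) / p : ℝ) *
        (q ^ (i + (m + 1)) * harmonic φ β (i + (m + 1)) x)) =
        (missCount n p (i + (m + 1)) / p : ℝ) * ((ψ (m + 1 + i) - ψ m * q ^ (i + 1)) *
          harmonic φ β (i + (m + 1)) x) := by
      rw [show m + 1 + i = i + (m + 1) by ring, show i + (m + 1) = m + (i + 1) by ring, pow_add]
      field_simp
    rw [h5, Real.norm_eq_abs, abs_mul, abs_mul,
      abs_of_nonneg (by positivity : (0 : ℝ) ≤ missCount n p (i + (m + 1)) / p)]
    calc _ ≤ (missCount n p (i + (m + 1)) / p : ℝ) * ((ψ m * ((i + 1) * ε * ρ ^ i)) * B) := by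
          gcongr
      _ = _ := by ring
  have hX : 0 ≤ ψ m * ε * B / p := by positivity
  have e1 : |remainder ψ β n p φ x - ψ m / q ^ m * remainder (fun k => q ^ k) β n p φ x| ≤
      (ψ m * ε * B / p) * (p * (4 / (1 - q) ^ 2)) := by
    rw [← h2.tsum_eq]
    have hs := hasSum_choose_mul_geometric_of_norm_lt_one 1 hnorm
    rw [hρ1] at hs
    have hs' := (hs.mul_left (p : ℝ)).mul_left (ψ m * ε * B / p)
    refine (tsum_of_norm_bounded hs' fun i => (hterm i).trans ?_).trans_eq ?_
    · rw [Nat.choose_one_right]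
      push_cast
      gcongr
      exact_mod_cast missCount_le hpn _
    · field_simp
      ring
  have e2 : |remainder ψ β n p φ x - ψ m / q ^ m * remainder (fun k => q ^ k) β n p φ x| ≤
      (ψ m * ε * B / p) * (16 / (1 - q) ^ 3) := by
    rw [← h2.tsum_eq]
    have hs := hasSum_choose_mul_geometric_of_norm_lt_one 2 hnorm
    rw [hρ1] at hs
    have hs' := (hs.mul_left (2 : ℝ)).mul_left (ψ m * ε * B / p)
    refine (tsum_of_norm_bounded hs' fun i => (hterm i).trans ?_).trans_eq ?_
    · refine mul_le_mul_of_nonneg_left ?_ hX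
      have hc : (missCount n p (i + (m + 1)) : ℝ) ≤ i + 2 := by
        have := missCount_le_sub n p (i + (m + 1))
        have h6 : missCount n p (i + (m + 1)) ≤ i + 2 := by omega
        exact_mod_cast h6
      rw [Nat.cast_choose_two]
      push_cast
      calc _ ≤ ((i : ℝ) + 2) * ((i + 1) * ρ ^ i) := by gcongr
        _ = _ := by ring
    · field_simp
      ring
  rw [mul_min_of_nonneg _ _ (by positivity), mul_min_of_nonneg _ _ (by positivity)]
  refine le_min (e1.trans ?_) (e2.trans_eq ?_)
  · have : 0 ≤ ψ m * ε * B / p * (p * (12 / (1 - q) ^ 2)) := by positivity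
    refine (le_add_of_nonneg_right this).trans_eq ?_
    field_simp; norm_num
  · field_simp

/-! ### Passage to the suprema -/

theorem abs_normC_sub_le {u v : ℝ → ℝ} {c D U V : ℝ} (hc : 0 ≤ c) (hu : ∀ x, |u x| ≤ U)
    (hv : ∀ x, |v x| ≤ V) (h : ∀ x, |u x - c * v x| ≤ D) : |normC u - c * normC v| ≤ D := by
  have bu : BddAbove (range fun x => |u x|) := ⟨U, by rintro _ ⟨x, rfl⟩; exact hu x⟩
  have bv : BddAbove (range fun x => |v x|) := ⟨V, by rintro _ ⟨x, rfl⟩; exact hv x⟩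
  rw [abs_le]
  unfold normC
  constructor
  · rw [Real.mul_iSup_of_nonneg hc]
    have : ⨆ x, c * |v x| ≤ (⨆ x, |u x|) + D := by
      refine ciSup_le fun x => ?_
      have h1 := le_ciSup bu x
      have h2 := abs_sub_abs_le_abs_sub (c * v x) (u x)
      rw [abs_sub_comm, abs_mul, abs_of_nonneg hc] at h2
      linarith [h x]
    linarith
  · have : ⨆ x, |u x| ≤ c * (⨆ x, |v x|) + D := by
      refine ciSup_le fun x => ?_
      have h1 := mul_le_mul_of_nonneg_left (le_ciSup bv x) hc
      have h2 := abs_sub_abs_le_abs_sub (u x) (c * v x)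
      rw [abs_mul, abs_of_nonneg hc] at h2
      linarith [h x]
    linarith

theorem abs_sSup_image_sub_le {α : Type*} {S : Set α} (hS : S.Nonempty) {F G : α → ℝ} {c D : ℝ}
    (hc : 0 ≤ c) (hF : BddAbove (F '' S)) (hG : BddAbove (G '' S))
    (h : ∀ a ∈ S, |F a - c * G a| ≤ D) : |sSup (F '' S) - c * sSup (G '' S)| ≤ D := by
  rw [abs_le]
  constructor
  · rcases hc.eq_or_lt with rfl | hc
    · obtain ⟨a, ha⟩ := hS
      have h1 := le_csSup hF (mem_image_of_mem F ha)
      have h2 := (abs_le.1 (h a ha)).1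
      linarith
    · have : sSup (G '' S) ≤ (sSup (F '' S) + D) / c := by
        refine csSup_le (hS.image G) ?_
        rintro _ ⟨a, ha, rfl⟩
        rw [le_div_iff₀ hc]
        have h1 := le_csSup hF (mem_image_of_mem F ha)
        have h2 := (abs_le.1 (h a ha)).1
        linarith
      rw [le_div_iff₀ hc] at this
      linarith
  · have : sSup (F '' S) ≤ c * sSup (G '' S) + D := by
      refine csSup_le (hS.image F) ?_
      rintro _ ⟨a, ha, rfl⟩
      have h1 := mul_le_mul_of_nonneg_left (le_csSup hG (mem_image_of_mem G ha)) hc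
      have h2 := (abs_le.1 (h a ha)).2
      linarith
    linarith

theorem bddAbove_errorSet {ψ : ℕ → ℝ} {q β B : ℝ} {n p : ℕ} {N : Set (ℝ → ℝ)} (hq1 : q < 1)
    (hψ : MemD q ψ) (hB : ∀ φ ∈ N, ∀ k, 1 ≤ k → |fourierA φ k| + |fourierB φ k| ≤ B)
    (hp : 1 ≤ p) (hpn : p ≤ n) : BddAbove (errorSet (classC ψ β N) n p) := by
  rw [errorSet_classC_eq hψ.pos (hψ.summable hq1) hB hp hpn]
  refine ⟨(∑' j, |ψ j|) * B, ?_⟩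
  rintro _ ⟨φ, ⟨hφ, -⟩, rfl⟩
  exact ciSup_le fun x => abs_remainder_le (hψ.summable hq1) (hB φ hφ) hpn x

/-- Comparison of the errors on `C^ψ_β N` and `C^q_β N`, for a class `N` whose members have
Fourier coefficients at most `B` beyond `n - p`. -/
theorem abs_errorE_sub_le {ψ : ℕ → ℝ} {q ε β B B₀ : ℝ} {n p : ℕ} {N : Set (ℝ → ℝ)} (hq : 0 < q)
    (hq1 : q < 1) (hψ : MemD q ψ) (hp : 1 ≤ p) (hpn : p ≤ n)
    (hε : ∀ k, n - p + 1 ≤ k → |ψ (k + 1) / ψ k - q| ≤ ε) (hεq : ε ≤ (1 - q) / 2)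
    (hN : 0 ∈ N)
    (hB₀ : ∀ φ ∈ N, ∀ k, 1 ≤ k → |fourierA φ k| + |fourierB φ k| ≤ B₀)
    (hB : ∀ φ ∈ N, ∀ k, n - p + 1 ≤ k → |fourierA φ k| + |fourierB φ k| ≤ B) :
    |errorE (classC ψ β N) n p -
      ψ (n - p + 1) / q ^ (n - p + 1) * errorE (classPoisson q β N) n p| ≤
      ψ (n - p + 1) / p * (16 * B * (ε / (1 - q) ^ 2) * min (p : ℝ) (1 / (1 - q))) := by
  have hD := memD_pow hq
  have b1 := bddAbove_errorSet (β := β) hq1 hψ hB₀ hp hpn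
  have b2 := bddAbove_errorSet (β := β) hq1 hD hB₀ hp hpn
  have hc : 0 ≤ ψ (n - p + 1) / q ^ (n - p + 1) :=
    div_nonneg (hψ.pos _ (by omega)).le (by positivity)
  unfold errorE classPoisson
  rw [errorSet_classC_eq hψ.pos (hψ.summable hq1) hB₀ hp hpn] at b1 ⊢
  rw [errorSet_classC_eq hD.pos (hD.summable hq1) hB₀ hp hpn] at b2 ⊢
  have h0 : (0 : ℝ → ℝ) ∈ {φ ∈ N | φ ∈ spaceL 1 ∧ fourierA φ 0 = 0} :=
    ⟨hN, mem_spaceL_of_mem_spaceC ⟨fun _ => rfl, continuous_zero⟩ 1, by simp [fourierA]⟩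
  refine abs_sSup_image_sub_le ⟨0, h0⟩ hc b1 b2 ?_
  · rintro φ ⟨hφ, -⟩
    exact abs_normC_sub_le hc
      (abs_remainder_le (hψ.summable hq1) (hB₀ φ hφ) hpn)
      (abs_remainder_le (hD.summable hq1) (hB₀ φ hφ) hpn)
      (abs_remainder_sub_le hq hq1 hψ hp hpn hε hεq (hB₀ φ hφ) (hB φ hφ))

/-! ### Fourier coefficients on the unit ball of `L_s` -/

theorem integral_abs_le_of_mem_ballU {φ : ℝ → ℝ} {s : ℝ≥0∞} (hs : 1 ≤ s) (hφ : φ ∈ ballU s) :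
    IntervalIntegrable (fun t => |φ t|) volume (-π) π ∧ ∫ t in (-π)..π, |φ t| ≤ 2 * π := by
  obtain ⟨⟨hper, hmem⟩, hle, -⟩ := hφ
  have : IsFiniteMeasure periodMeasure := by unfold periodMeasure; infer_instance
  have hint : Integrable φ periodMeasure := hmem.integrable hs
  have hper' : Function.Periodic (fun t => |φ t|) (2 * π) := fun t => by simp [hper t]
  have hI : IntervalIntegrable (fun t => |φ t|) volume 0 (0 + 2 * π) := by
    rw [zero_add, intervalIntegrable_iff_integrableOn_Ioc_of_le two_pi_pos.le]
    exact hint.abs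
  refine ⟨hper'.intervalIntegrable two_pi_pos.ne' hI _ _, ?_⟩
  have h1 := hper'.intervalIntegral_add_eq (-π) 0
  rw [show -π + 2 * π = π by ring, zero_add, intervalIntegral.integral_of_le two_pi_pos.le] at h1
  have h2 : ∫ t in Ioc 0 (2 * π), |φ t| = (eLpNorm φ 1 periodMeasure).toReal := by
    rw [eLpNorm_one_eq_lintegral_enorm, ← integral_norm_eq_lintegral_enorm hmem.1]
    rfl
  rw [h1, h2]
  have huniv : periodMeasure univ = ENNReal.ofReal (2 * π) := by
    simp [periodMeasure]
  have h3 : eLpNorm φ 1 periodMeasure ≤ ENNReal.ofReal (2 * π) := by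
    refine (eLpNorm_le_eLpNorm_mul_rpow_measure_univ hs hmem.1).trans ?_
    refine (mul_le_mul' hle le_rfl).trans ?_
    rw [one_mul, huniv]
    -- the exponent `1 - 1 / s` is at most `1`, and the period is at least `1`
    have h4 : (1 : ℝ≥0∞) ≤ ENNReal.ofReal (2 * π) := by
      rw [ENNReal.one_le_ofReal]; linarith [pi_gt_three]
    refine (ENNReal.rpow_le_rpow_of_exponent_le h4 (y := 1 / (1 : ℝ≥0∞).toReal -
      1 / s.toReal) (z := 1) ?_).trans_eq (ENNReal.rpow_one _)
    have : 0 ≤ 1 / s.toReal := by positivity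
    simp only [ENNReal.toReal_one]
    linarith
  exact ENNReal.toReal_le_of_le_ofReal two_pi_pos.le h3

theorem abs_fourier_le_of_mem_ballU {φ : ℝ → ℝ} {s : ℝ≥0∞} (hs : 1 ≤ s) (hφ : φ ∈ ballU s)
    (k : ℕ) : |fourierA φ k| + |fourierB φ k| ≤ 4 := by
  obtain ⟨hI, hle⟩ := integral_abs_le_of_mem_ballU hs hφ
  have key : ∀ g : ℝ → ℝ, (∀ t, |g t| ≤ 1) → |(1 / π) * ∫ t in (-π)..π, φ t * g t| ≤ 2 := by
    intro g hg
    have h1 := intervalIntegral.norm_integral_le_of_norm_le (f := fun t => φ t * g t)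
      (by linarith [pi_pos] : -π ≤ π)
      (ae_of_all _ fun t _ => by
        rw [Real.norm_eq_abs, abs_mul]
        exact mul_le_of_le_one_right (abs_nonneg _) (hg t)) hI
    rw [Real.norm_eq_abs] at h1
    rw [abs_mul, abs_of_pos (by positivity : 0 < 1 / π), one_div_mul_eq_div, div_le_iff₀ pi_pos]
    exact h1.trans hle
  have h1 := key (fun t => Real.cos (k * t)) fun t => Real.abs_cos_le_one _
  have h2 := key (fun t => Real.sin (k * t)) fun t => Real.abs_sin_le_one _
  unfold fourierA fourierB
  linarith

theorem zero_mem_ballU (s : ℝ≥0∞) : 0 ∈ ballU s :=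
  ⟨mem_spaceL_of_mem_spaceC ⟨fun _ => rfl, continuous_zero⟩ s, by simp, by simp⟩

/-! ### Fourier coefficients on `H_ω` -/

theorem IsModulus.nonneg {ω : ℝ → ℝ} (hω : IsModulus ω) {t : ℝ} (ht : 0 ≤ t) : 0 ≤ ω t := by
  rw [← hω.zero]
  exact hω.monotoneOn (mem_Ici.2 le_rfl) ht ht

theorem IsModulus.pi_div_le {ω : ℝ → ℝ} (hω : IsModulus ω) {k : ℕ} (hk : 1 ≤ k) :
    ω (π / k) ≤ 4 * ω (1 / k) := by
  have hk0 : (0 : ℝ) < k := by exact_mod_cast hk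
  have h0 : (0 : ℝ) ≤ 1 / k := by positivity
  have h1 : ω (π / k) ≤ ω ((1 / k + 1 / k) + (1 / k + 1 / k)) := by
    refine hω.monotoneOn (mem_Ici.2 (by positivity)) (mem_Ici.2 (by positivity)) ?_
    rw [div_le_iff₀ hk0]
    field_simp
    linarith [pi_lt_four]
  have h2 := hω.subadditive (1 / k + 1 / k) (1 / k + 1 / k) (by positivity) (by positivity)
  have h3 := hω.subadditive (1 / k) (1 / k) h0 h0
  linarith

/-- The supremum defining `modulus φ` is a genuine one, as `φ` is bounded. -/
theorem abs_sub_le_of_mem_classH {φ ω : ℝ → ℝ} (hφ : φ ∈ classH ω) (x y : ℝ) :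
    |φ x - φ y| ≤ ω |x - y| := by
  obtain ⟨⟨hper, hc⟩, hmod⟩ := hφ
  obtain ⟨C, hC⟩ := (hper.isBounded_of_continuous two_pi_pos.ne' hc).exists_norm_le
  refine le_trans (?_ : _ ≤ modulus φ |x - y|) (hmod _ (abs_nonneg _))
  refine le_csSup ⟨C + C, ?_⟩ ⟨x, y, le_rfl, rfl⟩
  rintro _ ⟨u, v, -, rfl⟩
  exact (abs_sub _ _).trans
    (add_le_add (hC _ (mem_range_self u)) (hC _ (mem_range_self v)))

/-- Shifting by a half-period `h` of the oscillating factor `g` turns `2 ∫ φ g` into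
`∫ (φ - φ(· + h)) g`. -/
theorem abs_integral_mul_le_of_mem_classH {φ ω g : ℝ → ℝ} {h : ℝ} (hφ : φ ∈ classH ω)
    (hg : Continuous g) (hg1 : ∀ t, |g t| ≤ 1) (hgp : Function.Periodic g (2 * π))
    (hgh : ∀ t, g (t + h) = -g t) (hh : 0 ≤ h) :
    |∫ t in (-π)..π, φ t * g t| ≤ π * ω h := by
  have hc : Continuous φ := hφ.1.2
  have hper : Function.Periodic (fun t => φ t * g t) (2 * π) := hφ.1.1.mul hgp
  have h1 : ∫ t in (-π)..π, φ (t + h) * g (t + h) = ∫ t in (-π)..π, φ t * g t := by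
    rw [intervalIntegral.integral_comp_add_right (fun t => φ t * g t) h]
    have := hper.intervalIntegral_add_eq (-π + h) (-π)
    rwa [show -π + h + 2 * π = π + h by ring, show -π + 2 * π = π by ring] at this
  have h2 : 2 * ∫ t in (-π)..π, φ t * g t = ∫ t in (-π)..π, (φ t - φ (t + h)) * g t := by
    rw [two_mul]
    nth_rewrite 2 [← h1]
    rw [← intervalIntegral.integral_add (Continuous.intervalIntegrable (by fun_prop) _ _)
      (Continuous.intervalIntegrable (by fun_prop) _ _)]
    refine intervalIntegral.integral_congr fun t _ => ?_
    simp only [hgh]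
    ring
  have h3 : ‖∫ t in (-π)..π, (φ t - φ (t + h)) * g t‖ ≤ ω h * |π - -π| := by
    refine intervalIntegral.norm_integral_le_of_norm_le_const fun t _ => ?_
    rw [Real.norm_eq_abs, abs_mul]
    have := abs_sub_le_of_mem_classH hφ t (t + h)
    rw [sub_add_cancel_left, abs_neg, abs_of_nonneg hh] at this
    exact (mul_le_of_le_one_right (abs_nonneg _) (hg1 t)).trans this
  rw [← h2, Real.norm_eq_abs, abs_mul, abs_two,
    abs_of_nonneg (by linarith [pi_pos] : 0 ≤ π - -π)] at h3
  linarith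

theorem abs_fourier_le_of_mem_classH {φ ω : ℝ → ℝ} (hω : IsModulus ω) (hφ : φ ∈ classH ω)
    {m k : ℕ} (hm : 1 ≤ m) (hk : m ≤ k) :
    |fourierA φ k| + |fourierB φ k| ≤ 8 * ω (1 / m) := by
  have hm0 : (0 : ℝ) < m := by exact_mod_cast hm
  have hk0 : (0 : ℝ) < k := by exact_mod_cast hm.trans hk
  have hle : ω (π / k) ≤ 4 * ω (1 / m) := by
    refine (hω.pi_div_le (hm.trans hk)).trans ?_
    have : ω (1 / k) ≤ ω (1 / m) :=
      hω.monotoneOn (mem_Ici.2 (by positivity)) (mem_Ici.2 (by positivity))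
        (one_div_le_one_div_of_le hm0 (by exact_mod_cast hk))
    linarith
  have hshift : ∀ t : ℝ, (k : ℝ) * (t + π / k) = k * t + π := fun t => by field_simp
  have key : ∀ I : ℝ, |I| ≤ π * ω (π / k) → |(1 / π) * I| ≤ 4 * ω (1 / m) := by
    intro I hI
    rw [abs_mul, abs_of_pos (by positivity : 0 < 1 / π), one_div_mul_eq_div, div_le_iff₀ pi_pos]
    nlinarith [pi_pos]
  have h1 := key _ (abs_integral_mul_le_of_mem_classH (g := fun t => Real.cos (k * t)) hφ
    (by fun_prop) (fun t => Real.abs_cos_le_one _)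
    (fun t => by simp only [mul_add, Real.cos_add_nat_mul_two_pi])
    (fun t => by rw [hshift, Real.cos_add_pi]) (by positivity))
  have h2 := key _ (abs_integral_mul_le_of_mem_classH (g := fun t => Real.sin (k * t)) hφ
    (by fun_prop) (fun t => Real.abs_sin_le_one _)
    (fun t => by simp only [mul_add, Real.sin_add_nat_mul_two_pi])
    (fun t => by rw [hshift, Real.sin_add_pi]) (by positivity))
  unfold fourierA fourierB
  linarith

theorem zero_mem_classH {ω : ℝ → ℝ} (hω : IsModulus ω) : 0 ∈ classH ω := by
  refine ⟨⟨fun _ => rfl, continuous_zero⟩, fun t ht => ?_⟩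
  refine csSup_le ⟨0, 0, 0, by simpa using ht, by simp⟩ ?_
  rintro _ ⟨x, y, -, rfl⟩
  simpa using hω.nonneg ht

/-! ### The ratios of `ψ` and the factor `δ` -/

theorem bddAbove_ratio {q : ℝ} {ψ : ℕ → ℝ} (hψ : MemD q ψ) (m : ℕ) :
    BddAbove ((fun k : ℕ => |ψ (k + 1) / ψ k - q|) '' Ici m) :=
  ((hψ.tendsto_ratio.sub_const q).abs.bddAbove_range).mono (image_subset_range _ _)

theorem exists_factor_of_abs_sub_le {E E' c d K W : ℝ} {p : ℝ} (hc : 0 < c) (hd : 0 < d)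
    (hp : 0 < p) (hK : 0 ≤ K) (hW : 0 ≤ W) (h : |E - c / d * E'| ≤ c / p * (K * W)) :
    ∃ δ : ℝ, |δ| ≤ K ∧ E = c / p * (p * E' / d + δ * W) := by
  -- if the scale `W` vanishes, the two errors agree exactly and `δ = 0` works
  rcases hW.eq_or_lt with rfl | hW
  · refine ⟨0, by simpa using hK, ?_⟩
    rw [mul_zero, mul_zero] at h
    rw [sub_eq_zero.1 (abs_nonpos_iff.1 h)]
    field_simp
    ring
  · refine ⟨(E - c / d * E') / (c / p * W), ?_, ?_⟩
    · rw [abs_div, abs_of_pos (by positivity : 0 < c / p * W), div_le_iff₀ (by positivity)]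
      linarith
    · field_simp
      ring

end VPSums

end

theorem theorem1 :
    ∃ K : ℝ, 0 < K ∧
      ∀ (q : ℝ) (ψ : ℕ → ℝ), 0 < q → q < 1 → VPSums.MemD q ψ →
        ∃ N : ℕ, ∀ n p : ℕ, 1 ≤ p → p ≤ n → N ≤ n - p → ∀ β : ℝ,
          (∀ s : ℝ≥0∞, 1 ≤ s →
            BddAbove (VPSums.errorSet (VPSums.classC ψ β (VPSums.ballU s)) n p) ∧
            BddAbove (VPSums.errorSet (VPSums.classPoisson q β (VPSums.ballU s)) n p) ∧
            ∃ δ : ℝ, |δ| ≤ K ∧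
              VPSums.errorE (VPSums.classC ψ β (VPSums.ballU s)) n p =
                ψ (n - p + 1) / p *
                  (p * VPSums.errorE (VPSums.classPoisson q β (VPSums.ballU s)) n p
                      / q ^ (n - p + 1) +
                    δ * (VPSums.eps q ψ (n - p + 1) / (1 - q) ^ 2) *
                      min (p : ℝ) (1 / (1 - q)))) ∧
          (∀ ω : ℝ → ℝ, VPSums.IsModulus ω →
            BddAbove (VPSums.errorSet (VPSums.classC ψ β (VPSums.classH ω)) n p) ∧
            BddAbove (VPSums.errorSet (VPSums.classPoisson q β (VPSums.classH ω)) n p) ∧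
            ∃ δ : ℝ, |δ| ≤ K ∧
              VPSums.errorE (VPSums.classC ψ β (VPSums.classH ω)) n p =
                ψ (n - p + 1) / p *
                  (p * VPSums.errorE (VPSums.classPoisson q β (VPSums.classH ω)) n p
                      / q ^ (n - p + 1) +
                    δ * ω (1 / ((n - p + 1 : ℕ) : ℝ)) *
                      (VPSums.eps q ψ (n - p + 1) / (1 - q) ^ 2) *
                      min (p : ℝ) (1 / (1 - q)))) := by
  -- `128 = 16 * 8`, the larger of the constants for the two kinds of classes
  refine ⟨128, by norm_num, fun q ψ hq hq1 hψ => ?_⟩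
  have hq2 : 0 < 1 - q := by linarith
  obtain ⟨N, hN⟩ := Metric.tendsto_atTop.1 hψ.tendsto_ratio ((1 - q) / 2) (by linarith)
  refine ⟨N, fun n p hp hpn hNp β => ?_⟩
  have hp0 : (0 : ℝ) < p := by exact_mod_cast hp
  have hψm := hψ.pos (n - p + 1) (by omega)
  have hε : ∀ k, n - p + 1 ≤ k → |ψ (k + 1) / ψ k - q| ≤ VPSums.eps q ψ (n - p + 1) :=
    fun k hk => le_csSup (VPSums.bddAbove_ratio hψ _) ⟨k, hk, rfl⟩
  have hεq : VPSums.eps q ψ (n - p + 1) ≤ (1 - q) / 2 := by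
    refine csSup_le (nonempty_Ici.image _) ?_
    rintro _ ⟨k, hk, rfl⟩
    rw [mem_Ici] at hk
    exact (hN k (by omega)).le
  have hε0 : 0 ≤ VPSums.eps q ψ (n - p + 1) := (abs_nonneg _).trans (hε _ le_rfl)
  have hmin : 0 ≤ min (p : ℝ) (1 / (1 - q)) := by positivity
  constructor
  · intro s hs
    have hB : ∀ φ ∈ VPSums.ballU s, ∀ k,
        |VPSums.fourierA φ k| + |VPSums.fourierB φ k| ≤ 4 :=
      fun φ hφ k => VPSums.abs_fourier_le_of_mem_ballU hs hφ k
    refine ⟨VPSums.bddAbove_errorSet hq1 hψ (fun φ hφ k _ => hB φ hφ k) hp hpn,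
      VPSums.bddAbove_errorSet hq1 (VPSums.memD_pow hq) (fun φ hφ k _ => hB φ hφ k) hp hpn, ?_⟩
    have key := VPSums.abs_errorE_sub_le (β := β) hq hq1 hψ hp hpn hε hεq
      (VPSums.zero_mem_ballU s) (fun φ hφ k _ => hB φ hφ k) (fun φ hφ k _ => hB φ hφ k)
    obtain ⟨δ, hδ, hE⟩ := VPSums.exists_factor_of_abs_sub_le (K := 64)
      (W := VPSums.eps q ψ (n - p + 1) / (1 - q) ^ 2 * min (p : ℝ) (1 / (1 - q))) hψm
      (pow_pos hq (n - p + 1)) hp0 (by norm_num) (by positivity) (key.trans_eq (by ring))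
    exact ⟨δ, hδ.trans (by norm_num), by rw [hE]; ring⟩
  · intro ω hω
    have hB₀ : ∀ φ ∈ VPSums.classH ω, ∀ k, 1 ≤ k →
        |VPSums.fourierA φ k| + |VPSums.fourierB φ k| ≤ 8 * ω (1 / (1 : ℕ)) :=
      fun φ hφ k hk => VPSums.abs_fourier_le_of_mem_classH hω hφ le_rfl hk
    refine ⟨VPSums.bddAbove_errorSet hq1 hψ hB₀ hp hpn,
      VPSums.bddAbove_errorSet hq1 (VPSums.memD_pow hq) hB₀ hp hpn, ?_⟩
    have key := VPSums.abs_errorE_sub_le (β := β) hq hq1 hψ hp hpn hε hεq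
      (VPSums.zero_mem_classH hω) hB₀
      (fun φ hφ k hk => VPSums.abs_fourier_le_of_mem_classH hω hφ (by omega) hk)
    have hω0 : 0 ≤ ω (1 / ((n - p + 1 : ℕ) : ℝ)) := hω.nonneg (by positivity)
    obtain ⟨δ, hδ, hE⟩ := VPSums.exists_factor_of_abs_sub_le (K := 128)
      (W := ω (1 / ((n - p + 1 : ℕ) : ℝ)) * (VPSums.eps q ψ (n - p + 1) / (1 - q) ^ 2) *
        min (p : ℝ) (1 / (1 - q))) hψm
      (pow_pos hq (n - p + 1)) hp0 (by norm_num) (by positivity) (key.trans_eq (by ring))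
    exact ⟨δ, hδ, by rw [hE]; ring⟩
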